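/- **Setup.** Let $X=([0,1]\times\mathbb R^3)/\widehat\Lambda$ with the quotient topology, with coordinates $(P,T,U_1,U_2)$, where $\widehat\Lambda$ is the abelian group generated by $T_1(P,T,U_1,U_2)=(P,T+2,U_1+P,U_2+P)$, $T_2(P,T,U_1,U_2)=(P,T,U_1+2,U_2)$, $T_3(P,T,U_1,U_2)=(P,T,U_1,U_2+2)$. The set $[0,1]\times[-1,1]^3$ is a fundamental domain. *Tiles.* A tile type is a set of edges of a unit square, chosen from $\{N,S,E,W\}$, that is either empty (empty tile) or has two elements (the tile with a connector joining the midpoints of those two edges); there are seven types. *Partition.* For $P\in[0,1]$ and $T\in[-1,1]$ define $u_1\le u_2\le u_3$ and a $4\times4$ array $M$ by $$T\in[-1,-1+P]:\quad (u_1,u_2,u_3)=(T,\,1-P,\,2-P+T),\quad M=\begin{pmatrix}0&0&0&W\\N&0&0&0\\0&E&0&0\\0&0&S&0\end{pmatrix};$$ $$T\in[-1+P,1-P]:\quad (u_1,u_2,u_3)=(-1+P,\,T,\,1-P),\quad M=\begin{pmatrix}N&0&0&0\\0&0&E&0\\0&W&0&0\\0&0&0&S\end{pmatrix};$$ $$T\in[1-P,1]:\quad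 (u_1,u_2,u_3)=(-2+P+T,\,-1+P,\,T),\quad M=\begin{pmatrix}0&N&0&0\\0&0&W&0\\0&0&0&S\\E&0&0&0\end{pmatrix}.$$ The lines $U_1=u_i$ and $U_2=u_i$ cut the square $[-1,1]^2$ of points $(U_1,U_2)$ into a $4\times4$ grid of closed (possibly degenerate) rectangles, arranged like the entries of $M$, with the first row of $M$ on top ($U_2$ largest) and the first column at the left ($U_1$ smallest). A rectangle whose entry of $M$ is nonzero is labelled by the empty tile; any other rectangle is labelled by the pair consisting of the symbol in its row of $M$ and the symbol in its column of $M$. For a tile type $t$, the piece $X_t\subset X$ is the image in $X$ of the union, over all $(P,T)\in[0,1]\times[-1,1]$, of the rectangles labelled $t$. *Offsets and tilings.* For $P\in[0,1]$ and an offset $V\in\mathbb R^3$ let $$\Xi_{P,V}(x,y)=\bigl(P,\ (2Px+2y,\ 2Px,\ 2Px+2Py)+V\bigr)\ \bmod \widehat\Lambda .$$ Call $V$ a *good offset* for $P$ if $\Xi_{P,V}$ maps the center $(m+\tfrac12,n+\tfrac12)$ of every unit square $[m,m+1]\times[n,n+1]$, $m,n\in\mathbb Z$, into the union of the interiors (in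 $X$) of the seven pieces $X_t$. A tiling, i.e. an assignment of a tile type to each of these squares, is *defined by* $(\Xi_{P,V},X)$ if each square has a type $t$ such that $\Xi_{P,V}$ maps its center into the interior of $X_t$. A tiling is *coherent* if for any two squares sharing an edge, that edge is involved in the connectors of both tiles or of neither. **Lemma (Geometric Limit).** Let $P\in[0,1]$ (in particular, $P$ may be irrational), and let $V$ be a good offset for $P$. Then there is exactly one tiling defined by $(\Xi_{P,V},X)$, and this tiling is coherent. -/

import Mathlib

namespace Plaid

/-- The four edges (north, south, east, west) of a unit square. -/
inductive Side where
  | N | S | E | W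
  deriving DecidableEq

instance : Fintype Side where
  elems := {Side.N, Side.S, Side.E, Side.W}
  complete x := by cases x <;> simp

/-- A tile type, recorded as the set of edges involved in its connector: empty (no connector),
or an unordered pair of distinct edges.  There are seven of them. -/
abbrev TileType : Type := {s : Finset Side // s.card = 0 ∨ s.card = 2}

/-- The points `(P, (T, U₁, U₂))` of `[0,1] × ℝ³`. -/
abbrev Cover : Type := Set.Icc (0 : ℝ) 1 × (ℝ × ℝ × ℝ)

/-- Two points of `[0,1] × ℝ³` are equivalent when they differ by an element
`T₁ᵃ T₂ᵇ T₃ᶜ` of the abelian group generated by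
`T₁ (P, T, U₁, U₂) = (P, T + 2, U₁ + P, U₂ + P)`, `T₂ (P, T, U₁, U₂) = (P, T, U₁ + 2, U₂)` and
`T₃ (P, T, U₁, U₂) = (P, T, U₁, U₂ + 2)`. -/
def latticeSetoid : Setoid Cover where
  r x y := x.1 = y.1 ∧ ∃ a b c : ℤ,
    y.2 = (x.2.1 + 2 * a, x.2.2.1 + a * (x.1 : ℝ) + 2 * b, x.2.2.2 + a * (x.1 : ℝ) + 2 * c)
  iseqv := by
    refine ⟨fun x => ⟨rfl, 0, 0, 0, by simp⟩, ?_, ?_⟩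
    · rintro ⟨P, t, u, v⟩ ⟨P', t', u', v'⟩ ⟨h, a, b, c, e⟩
      simp only [Prod.mk.injEq] at h e
      obtain ⟨rfl, rfl, rfl⟩ := e
      subst h
      refine ⟨rfl, -a, -b, -c, ?_⟩
      ext <;> push_cast <;> ring
    · rintro ⟨P, t, u, v⟩ ⟨P', t', u', v'⟩ ⟨P'', t'', u'', v''⟩ ⟨h, a, b, c, e⟩ ⟨h', a', b', c', e'⟩
      simp only [Prod.mk.injEq] at h e h' e'
      obtain ⟨rfl, rfl, rfl⟩ := e
      obtain ⟨rfl, rfl, rfl⟩ := e'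
      subst h
      subst h'
      refine ⟨rfl, a + a', b + b', c + c', ?_⟩
      ext <;> push_cast <;> ring

/-- The classifying space `X`, with the quotient topology. -/
abbrev X : Type := Quotient latticeSetoid

/-- The checkerboard data: three cutting values and a `4 × 4` matrix of symbols. The matrix is
laid out as in the plane: its first row is the top row, its first column is the left column. -/
structure Board where
  cut : Fin 3 → ℝ
  mat : Matrix (Fin 4) (Fin 4) (Option Side)

/-- The breakpoints `-1 ≤ u₁ ≤ u₂ ≤ u₃ ≤ 1` of the interval `[-1, 1]`. -/
def Board.brk (B : Board) : Fin 5 → ℝ := ![-1, B.cut 0, B.cut 1, B.cut 2, 1]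

/-- The closed rectangle of the checkerboard in row `i` (from the top) and column `j` (from the
left); the horizontal coordinate is the first one. -/
def Board.rect (B : Board) (i j : Fin 4) : Set (ℝ × ℝ) :=
  Set.Icc (B.brk j.castSucc) (B.brk j.succ) ×ˢ
    Set.Icc (B.brk i.rev.castSucc) (B.brk i.rev.succ)

/-- The edges of the connector attached to the rectangle in row `i` and column `j`. A special
rectangle (one that carries a symbol of the matrix) has the empty tile; any other one gets
the symbol of its row and the symbol of its column. -/
def Board.label (B : Board) (i j : Fin 4) : Finset Side :=
  if (B.mat i j).isSome then ∅
  else Finset.univ.filter fun s => ∃ k, B.mat i k = some s ∨ B.mat k j = some s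

open Side in
/-- The data over `-1 ≤ T ≤ -1 + P`. -/
def board₁ (P T : ℝ) : Board where
  cut := ![T, 1 - P, 2 - P + T]
  mat := !![none,   none,   none,   some W;
            some N, none,   none,   none;
            none,   some E, none,   none;
            none,   none,   some S, none]

open Side in
/-- The data over `-1 + P ≤ T ≤ 1 - P`. -/
def board₂ (P T : ℝ) : Board where
  cut := ![-1 + P, T, 1 - P]
  mat := !![some N, none,   none,   none;
            none,   none,   some E, none;
            none,   some W, none,   none;
            none,   none,   none,   some S]

open Side in
/-- The data over `1 - P ≤ T ≤ 1`. -/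
def board₃ (P T : ℝ) : Board where
  cut := ![-2 + P + T, -1 + P, T]
  mat := !![none,   some N, none,   none;
            none,   none,   some W, none;
            none,   none,   none,   some S;
            some E, none,   none,   none]

/-- `IsBoard P T B` says that `B` is checkerboard data for the fiber over `(P, T)`. -/
def IsBoard (P T : ℝ) (B : Board) : Prop :=
  (T ∈ Set.Icc (-1) (-1 + P) ∧ B = board₁ P T) ∨
  (T ∈ Set.Icc (-1 + P) (1 - P) ∧ B = board₂ P T) ∨
  (T ∈ Set.Icc (1 - P) 1 ∧ B = board₃ P T)

/-- The piece of the partition of the fundamental domain `[0,1] × [-1,1]³` with label `t`: the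
union, over all fibers, of the closed rectangles with that label. -/
def domainPiece (t : TileType) : Set Cover :=
  {z | ∃ B : Board, IsBoard z.1 z.2.1 B ∧
    ∃ i j : Fin 4, B.label i j = t.1 ∧ z.2.2 ∈ B.rect i j}

/-- The piece of the partition of `X` with label `t`. -/
def piece (t : TileType) : Set X :=
  (Quotient.mk latticeSetoid) '' domainPiece t

/-- The map `Ξ_{P,V} : ℝ² → X`, that is
`(x, y) ↦ (P, (2Px + 2y, 2Px, 2Px + 2Py) + V)` modulo the lattice. -/
def Xi (P : Set.Icc (0 : ℝ) 1) (V : ℝ × ℝ × ℝ) (c : ℝ × ℝ) : X :=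
  Quotient.mk latticeSetoid
    (P, (2 * (P : ℝ) * c.1 + 2 * c.2, 2 * (P : ℝ) * c.1,
      2 * (P : ℝ) * c.1 + 2 * (P : ℝ) * c.2) + V)

/-- The center of the unit square `[m, m+1] × [n, n+1]`. -/
noncomputable def center (s : ℤ × ℤ) : ℝ × ℝ := (s.1 + 1 / 2, s.2 + 1 / 2)

/-- `V` is a good offset for `P`: every tile center is mapped into the interior of a piece. -/
def GoodOffset (P : Set.Icc (0 : ℝ) 1) (V : ℝ × ℝ × ℝ) : Prop :=
  ∀ s : ℤ × ℤ, ∃ t : TileType, Xi P V (center s) ∈ interior (piece t)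

/-- A tiling of the plane by unit squares, in which the square `[m, m+1] × [n, n+1]` carries the
tile type `τ (m, n)`. -/
abbrev Tiling : Type := ℤ × ℤ → TileType

/-- `τ` is defined by the pair `(Ξ_{P,V}, X)`: each square carries the label of the piece whose
interior contains the image of its center. -/
def IsTilingOf (P : Set.Icc (0 : ℝ) 1) (V : ℝ × ℝ × ℝ) (τ : Tiling) : Prop :=
  ∀ s : ℤ × ℤ, Xi P V (center s) ∈ interior (piece (τ s))

/-- Adjacent tiles match: their common edge is involved in both connectors or in neither. -/
def Coherent (τ : Tiling) : Prop :=
  ∀ m n : ℤ,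
    (Side.E ∈ (τ (m, n)).1 ↔ Side.W ∈ (τ (m + 1, n)).1) ∧
    (Side.N ∈ (τ (m, n)).1 ↔ Side.S ∈ (τ (m, n + 1)).1)

end Plaid

namespace Plaid

open Set Topology

/-! ### Generic points of the cover -/

/-! Both claims about interiors reduce to generic points. If a point and a translate of it project
into interiors of pieces, the same holds for some nearby generic point, with `P` perturbed too, so
walls and the extreme values of `P` disappear (`exists_generic_representatives`). A generic point
has at most one representative in the open fundamental cube, and there a side lies in the label
exactly when one, but not both, of the column and row arcs of that side contains the corresponding
coordinate (`Generic.mem_domainPiece`). This gives uniqueness of the type. For coherence, a step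
between neighbouring squares acts on each coordinate as a rotation of the circle `ℝ/2ℤ`. A step east
carries the `E` arc onto the `W` arc, or onto its complement in both coordinates at once, which
leaves the exclusive or unchanged. A step north carries the `N` arcs onto the `S` arcs. -/

/-- A point of the cover lying on none of the walls of the partition, nor on any wall obtained
from them by translations with coefficients in `ℤ + ℤP`. -/
structure Generic (z : Cover) : Prop where
  pos : 0 < (z.1 : ℝ)
  lt_one : (z.1 : ℝ) < 1
  fst : ∀ m n : ℤ, z.2.1 ≠ m + n * (z.1 : ℝ)
  snd : ∀ m n k : ℤ, z.2.2.1 ≠ m + n * (z.1 : ℝ) + k * z.2.1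
  trd : ∀ m n k : ℤ, z.2.2.2 ≠ m + n * (z.1 : ℝ) + k * z.2.1

/-- The excluded values of each coordinate form a family stable under adding elements of `ℤ + ℤP`; a
change of `T` is absorbed through the coefficient `k`. -/
theorem Generic.translate {z w : Cover} (hz : Generic z) (h : w.1 = z.1) (a₀ a b₀ b c₀ c : ℤ)
    (ht : w.2.1 = z.2.1 + (a₀ + a * (z.1 : ℝ))) (hu : w.2.2.1 = z.2.2.1 + (b₀ + b * (z.1 : ℝ)))
    (hv : w.2.2.2 = z.2.2.2 + (c₀ + c * (z.1 : ℝ))) : Generic w where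
  pos := h ▸ hz.pos
  lt_one := h ▸ hz.lt_one
  fst m n e := by
    rw [h, ht] at e
    refine hz.fst (m - a₀) (n - a) ?_
    push_cast
    linear_combination e
  snd m n k e := by
    rw [h, hu, ht] at e
    refine hz.snd (m - b₀ + k * a₀) (n - b + k * a) k ?_
    push_cast
    linear_combination e
  trd m n k e := by
    rw [h, hv, ht] at e
    refine hz.trd (m - c₀ + k * a₀) (n - c + k * a) k ?_
    push_cast
    linear_combination e

theorem Generic.of_rel {z w : Cover} (hz : Generic z) (h : latticeSetoid z w) : Generic w := by
  obtain ⟨h₁, a, b, c, e⟩ := h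
  refine hz.translate h₁.symm (2 * a) 0 (2 * b) a (2 * c) a ?_ ?_ ?_ <;> rw [e] <;> push_cast <;>
    ring

theorem exists_mem_open_ne {ι : Type*} [Countable ι] (f : ι → ℝ) {s : Set ℝ} (hs : IsOpen s)
    (hne : s.Nonempty) : ∃ x ∈ s, ∀ i, x ≠ f i := by
  obtain ⟨x, hx, hx'⟩ := ((countable_range f).dense_compl ℝ).exists_mem_open hs hne
  exact ⟨x, hx', fun i e => hx ⟨i, e.symm⟩⟩

theorem exists_generic {O : Set Cover} (hO : IsOpen O) (hne : O.Nonempty) :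
    ∃ z ∈ O, Generic z := by
  obtain ⟨⟨P, t, u, v⟩, hz⟩ := hne
  obtain ⟨Q, hQ, hQ0, hQ1⟩ : ∃ Q : Icc (0 : ℝ) 1, (Q, t, u, v) ∈ O ∧ 0 < (Q : ℝ) ∧ (Q : ℝ) < 1 := by
    have ho : IsOpen {Q : Icc (0 : ℝ) 1 | (Q, t, u, v) ∈ O} := hO.preimage (by fun_prop)
    obtain ⟨W, hW, hWe⟩ := isOpen_induced_iff.1 ho
    have hPW : (P : ℝ) ∈ W := by
      have : P ∈ Subtype.val ⁻¹' W := by rw [hWe]; exact hz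
      exact this
    -- The endpoints 0 and 1 are limits of interior values of `P`, so they too can be perturbed
    -- away.
    have hcl : (P : ℝ) ∈ closure (Ioo (0 : ℝ) 1) := by
      rw [closure_Ioo zero_ne_one]; exact P.2
    obtain ⟨q, hqW, hq⟩ := mem_closure_iff.1 hcl W hW hPW
    refine ⟨⟨q, hq.1.le, hq.2.le⟩, ?_, hq.1, hq.2⟩
    have : (⟨q, hq.1.le, hq.2.le⟩ : Icc (0 : ℝ) 1) ∈ Subtype.val ⁻¹' W := hqW
    rw [hWe] at this
    exact this
  obtain ⟨t', ht, ht'⟩ := exists_mem_open_ne (fun i : ℤ × ℤ => (i.1 + i.2 * (Q : ℝ) : ℝ))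
    (hO.preimage (f := fun t => ((Q, t, u, v) : Cover)) (by fun_prop)) ⟨t, hQ⟩
  obtain ⟨u', hu, hu'⟩ := exists_mem_open_ne
    (fun i : ℤ × ℤ × ℤ => (i.1 + i.2.1 * (Q : ℝ) + i.2.2 * t' : ℝ))
    (hO.preimage (f := fun u => ((Q, t', u, v) : Cover)) (by fun_prop)) ⟨u, ht⟩
  obtain ⟨v', hv, hv'⟩ := exists_mem_open_ne
    (fun i : ℤ × ℤ × ℤ => (i.1 + i.2.1 * (Q : ℝ) + i.2.2 * t' : ℝ))
    (hO.preimage (f := fun v => ((Q, t', u', v) : Cover)) (by fun_prop)) ⟨v, hu⟩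
  exact ⟨_, hv, hQ0, hQ1, fun m n => ht' (m, n), fun m n k => hu' (m, n, k),
    fun m n k => hv' (m, n, k)⟩

/-! ### The arcs carrying the symbols -/

/-- The open arc of the columns (and of the rows) carrying the symbol `E`. -/
def ArcE (P T U : ℝ) : Prop := (T < 1 - P ∧ T < U ∧ U < 1 - P) ∨ (1 - P < T ∧ U < -2 + P + T)

/-- The open arc of the columns (and of the rows) carrying the symbol `W`. -/
def ArcW (P T U : ℝ) : Prop :=
  (T < -1 + P ∧ 2 - P + T < U) ∨ (-1 + P < T ∧ -1 + P < U ∧ U < T)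

/-- The open arc of the columns carrying `N`, which is also that of the rows carrying `S`. -/
def ArcN (P T U : ℝ) : Prop :=
  (T < -1 + P ∧ U < T) ∨ (-1 + P < T ∧ T < 1 - P ∧ U < -1 + P) ∨
    (1 - P < T ∧ -2 + P + T < U ∧ U < -1 + P)

/-- The open arc of the columns carrying `S`, which is also that of the rows carrying `N`. -/
def ArcS (P T U : ℝ) : Prop :=
  (T < -1 + P ∧ 1 - P < U ∧ U < 2 - P + T) ∨ (-1 + P < T ∧ T < 1 - P ∧ 1 - P < U) ∨
    (1 - P < T ∧ T < U)

/-- The arc of the columns carrying the symbol `s`. -/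
def colArc (P T : ℝ) : Side → ℝ → Prop
  | .N => ArcN P T
  | .S => ArcS P T
  | .E => ArcE P T
  | .W => ArcW P T

/-- The arc of the rows carrying the symbol `s`. -/
def rowArc (P T : ℝ) : Side → ℝ → Prop
  | .N => ArcS P T
  | .S => ArcN P T
  | .E => ArcE P T
  | .W => ArcW P T

/-- `U` avoids the cutting values of all three boards. -/
def OffWalls (P T U : ℝ) : Prop :=
  U ≠ T ∧ U ≠ 1 - P ∧ U ≠ 2 - P + T ∧ U ≠ -1 + P ∧ U ≠ -2 + P + T ∧ U ≠ -1 ∧ U ≠ 1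

theorem offWalls_of_ne {P T U : ℝ} (h : ∀ m n k : ℤ, U ≠ m + n * P + k * T) : OffWalls P T U := by
  refine ⟨?_, ?_, ?_, ?_, ?_, ?_, ?_⟩ <;> intro e
  · exact h 0 0 1 (by push_cast; linarith)
  · exact h 1 (-1) 0 (by push_cast; linarith)
  · exact h 2 (-1) 1 (by push_cast; linarith)
  · exact h (-1) 1 0 (by push_cast; linarith)
  · exact h (-2) 1 1 (by push_cast; linarith)
  · exact h (-1) 0 0 (by push_cast; linarith)
  · exact h 1 0 0 (by push_cast; linarith)

theorem Generic.fst_ne {z : Cover} (hz : Generic z) :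
    z.2.1 ≠ -1 ∧ z.2.1 ≠ 1 ∧ z.2.1 ≠ -1 + (z.1 : ℝ) ∧ z.2.1 ≠ 1 - (z.1 : ℝ) := by
  refine ⟨?_, ?_, ?_, ?_⟩ <;> intro e
  · exact hz.fst (-1) 0 (by push_cast; linarith)
  · exact hz.fst 1 0 (by push_cast; linarith)
  · exact hz.fst (-1) 1 (by push_cast; linarith)
  · exact hz.fst 1 (-1) (by push_cast; linarith)

section Arcs

variable {P T U : ℝ} {k : Fin 4}

/-- Away from the walls a coordinate lies in the interior of one interval of the board, and the arcs
are these four intervals in the order of the column symbols. -/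
theorem board₁_arc (hP : P < 1) (h₁ : -1 < T) (h₂ : T < -1 + P) (hU : OffWalls P T U)
    (hk : U ∈ Icc ((board₁ P T).brk k.castSucc) ((board₁ P T).brk k.succ)) :
    U ∈ Ioo (-1) 1 ∧ (ArcN P T U ↔ k = 0) ∧ (ArcE P T U ↔ k = 1) ∧ (ArcS P T U ↔ k = 2) ∧
      (ArcW P T U ↔ k = 3) := by
  obtain ⟨e₁, e₂, e₃, e₄, e₅, e₆, e₇⟩ := hU
  fin_cases k <;> simp [Board.brk, board₁] at hk <;>
    simp only [ArcN, ArcE, ArcS, ArcW, mem_Ioo] <;> grind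

theorem board₂_arc (hP : 0 < P) (h₁ : -1 + P < T) (h₂ : T < 1 - P) (hU : OffWalls P T U)
    (hk : U ∈ Icc ((board₂ P T).brk k.castSucc) ((board₂ P T).brk k.succ)) :
    U ∈ Ioo (-1) 1 ∧ (ArcN P T U ↔ k = 0) ∧ (ArcW P T U ↔ k = 1) ∧ (ArcE P T U ↔ k = 2) ∧
      (ArcS P T U ↔ k = 3) := by
  obtain ⟨e₁, e₂, e₃, e₄, e₅, e₆, e₇⟩ := hU
  fin_cases k <;> simp [Board.brk, board₂] at hk <;>
    simp only [ArcN, ArcE, ArcS, ArcW, mem_Ioo] <;> grind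

theorem board₃_arc (hP : P < 1) (h₁ : 1 - P < T) (h₂ : T < 1) (hU : OffWalls P T U)
    (hk : U ∈ Icc ((board₃ P T).brk k.castSucc) ((board₃ P T).brk k.succ)) :
    U ∈ Ioo (-1) 1 ∧ (ArcE P T U ↔ k = 0) ∧ (ArcN P T U ↔ k = 1) ∧ (ArcW P T U ↔ k = 2) ∧
      (ArcS P T U ↔ k = 3) := by
  obtain ⟨e₁, e₂, e₃, e₄, e₅, e₆, e₇⟩ := hU
  fin_cases k <;> simp [Board.brk, board₃] at hk <;>
    simp only [ArcN, ArcE, ArcS, ArcW, mem_Ioo] <;> grind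

end Arcs

/-- The matrix does not depend on `P` and `T`, so a finite check at `(0, 0)` serves every fiber. The
exclusive or also covers special rectangles: there the row and column symbols coincide and cancel to
the empty tile. Rows are counted from the top while `U₂` increases upwards, hence `i.rev`. -/
theorem board₁_symbols (s : Side) (i : Fin 4) :
    (∀ j, s ∈ (board₁ 0 0).label i j ↔
      Xor (∃ k, (board₁ 0 0).mat k j = some s) (∃ k, (board₁ 0 0).mat i k = some s)) ∧
    ((∃ k, (board₁ 0 0).mat k i = some s) ↔
      i = match s with | .N => 0 | .E => 1 | .S => 2 | .W => 3) ∧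
    ((∃ k, (board₁ 0 0).mat i k = some s) ↔
      i.rev = match s with | .S => 0 | .E => 1 | .N => 2 | .W => 3) := by
  simp only [Xor]
  cases s <;> fin_cases i <;> decide

theorem board₂_symbols (s : Side) (i : Fin 4) :
    (∀ j, s ∈ (board₂ 0 0).label i j ↔
      Xor (∃ k, (board₂ 0 0).mat k j = some s) (∃ k, (board₂ 0 0).mat i k = some s)) ∧
    ((∃ k, (board₂ 0 0).mat k i = some s) ↔
      i = match s with | .N => 0 | .W => 1 | .E => 2 | .S => 3) ∧
    ((∃ k, (board₂ 0 0).mat i k = some s) ↔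
      i.rev = match s with | .S => 0 | .W => 1 | .E => 2 | .N => 3) := by
  simp only [Xor]
  cases s <;> fin_cases i <;> decide

theorem board₃_symbols (s : Side) (i : Fin 4) :
    (∀ j, s ∈ (board₃ 0 0).label i j ↔
      Xor (∃ k, (board₃ 0 0).mat k j = some s) (∃ k, (board₃ 0 0).mat i k = some s)) ∧
    ((∃ k, (board₃ 0 0).mat k i = some s) ↔
      i = match s with | .E => 0 | .N => 1 | .W => 2 | .S => 3) ∧
    ((∃ k, (board₃ 0 0).mat i k = some s) ↔
      i.rev = match s with | .E => 0 | .S => 1 | .W => 2 | .N => 3) := by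
  simp only [Xor]
  cases s <;> fin_cases i <;> decide

/-- For a generic point of a piece, the coordinates lie in the open interval `(-1, 1)` and the
label is read off from the arcs. -/
theorem Generic.mem_domainPiece {z : Cover} (hz : Generic z) {t : TileType}
    (h : z ∈ domainPiece t) :
    (z.2.1 ∈ Ioo (-1) 1 ∧ z.2.2.1 ∈ Ioo (-1) 1 ∧ z.2.2.2 ∈ Ioo (-1) 1) ∧
      ∀ s, s ∈ t.1 ↔ Xor (colArc z.1 z.2.1 s z.2.2.1) (rowArc z.1 z.2.1 s z.2.2.2) := by
  obtain ⟨B, hB, i, j, hl, hu, hv⟩ := h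
  have hP0 := hz.pos
  have hP1 := hz.lt_one
  obtain ⟨n₁, n₂, n₃, n₄⟩ := hz.fst_ne
  have ou := offWalls_of_ne hz.snd
  have ov := offWalls_of_ne hz.trd
  rw [← hl]
  rcases hB with ⟨⟨h₁, h₂⟩, rfl⟩ | ⟨⟨h₁, h₂⟩, rfl⟩ | ⟨⟨h₁, h₂⟩, rfl⟩
  · have h₁ := lt_of_le_of_ne h₁ n₁.symm
    have h₂ := lt_of_le_of_ne h₂ n₃
    have au := board₁_arc hP1 h₁ h₂ ou hu
    have av := board₁_arc hP1 h₁ h₂ ov hv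
    refine ⟨⟨⟨by linarith, by linarith⟩, au.1, av.1⟩, fun s => ?_⟩
    refine ((board₁_symbols s i).1 j).trans ?_
    rw [(board₁_symbols s j).2.1, (board₁_symbols s i).2.2]
    cases s <;> simp only [colArc, rowArc, au, av]
  · have h₁ := lt_of_le_of_ne h₁ n₃.symm
    have h₂ := lt_of_le_of_ne h₂ n₄
    have au := board₂_arc hP0 h₁ h₂ ou hu
    have av := board₂_arc hP0 h₁ h₂ ov hv
    refine ⟨⟨⟨by linarith, by linarith⟩, au.1, av.1⟩, fun s => ?_⟩
    refine ((board₂_symbols s i).1 j).trans ?_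
    rw [(board₂_symbols s j).2.1, (board₂_symbols s i).2.2]
    cases s <;> simp only [colArc, rowArc, au, av]
  · have h₁ := lt_of_le_of_ne h₁ n₄.symm
    have h₂ := lt_of_le_of_ne h₂ n₂
    have au := board₃_arc hP1 h₁ h₂ ou hu
    have av := board₃_arc hP1 h₁ h₂ ov hv
    refine ⟨⟨⟨by linarith, by linarith⟩, au.1, av.1⟩, fun s => ?_⟩
    refine ((board₃_symbols s i).1 j).trans ?_
    rw [(board₃_symbols s j).2.1, (board₃_symbols s i).2.2]
    cases s <;> simp only [colArc, rowArc, au, av]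

/-! ### Translations -/

section Shift

variable {P T T' U U' : ℝ} {a b : ℤ}

theorem int_cases_of_abs_lt {x : ℝ} (h : x = 2 * b) (h₁ : -4 < x) (h₂ : x < 4) :
    b = -1 ∨ b = 0 ∨ b = 1 := by
  have h₃ : (-2 : ℝ) < b := by linarith
  have h₄ : (b : ℝ) < 2 := by linarith
  have h₃ : -2 < b := by exact_mod_cast h₃
  have h₄ : b < 2 := by exact_mod_cast h₄
  omega

/-- This is the eastward step followed by `T₁⁻¹`, which leaves a rotation by `P`. For `T < 1 - P`
the arc `(T, 1 - P)` moves to `(2 - P + T', 1)`; for `T > 1 - P` the arc `(-1, -2 + P + T)` moves to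
`(-1 + P, T')`. -/
theorem arcE_shift_of_neg (hP0 : 0 < P) (hP1 : P < 1) (hT : T ∈ Ioo (-1) 1) (hT' : T' ∈ Ioo (-1) 1)
    (hU : U ∈ Ioo (-1) 1) (hU' : U' ∈ Ioo (-1) 1) (n₂ : T' ≠ -1 + P)
    (eT : T' = T + 2 * P - 2) (eU : U' = U + P + 2 * b) : ArcE P T U ↔ ArcW P T' U' := by
  obtain ⟨t₁, t₂⟩ := hT
  obtain ⟨t₃, t₄⟩ := hT'
  obtain ⟨u₁, u₂⟩ := hU
  obtain ⟨u₃, u₄⟩ := hU'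
  rcases int_cases_of_abs_lt (x := U' - U - P) (by linarith) (by linarith) (by linarith) with
    rfl | rfl | rfl <;> push_cast at eU <;> subst eT eU <;> simp only [ArcE, ArcW] <;> grind

/-- Here `T < 1 - 2P`, and rotating `(T, 1 - P)` by `2P` gives the arc from `T'` through `1 = -1` to
`-1 + P`, the complement of `(-1 + P, T')` up to endpoints. -/
theorem arcE_shift_of_zero (hP0 : 0 < P) (hP1 : P < 1) (hT : T ∈ Ioo (-1) 1) (hT' : T' ∈ Ioo (-1) 1)
    (hU : U ∈ Ioo (-1) 1) (hU' : U' ∈ Ioo (-1) 1) (n₂ : T' ≠ -1 + P)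
    (oU : OffWalls P T U) (oU' : OffWalls P T' U')
    (eT : T' = T + 2 * P) (eU : U' = U + 2 * P + 2 * b) : ArcE P T U ↔ ¬ ArcW P T' U' := by
  obtain ⟨t₁, t₂⟩ := hT
  obtain ⟨t₃, t₄⟩ := hT'
  obtain ⟨u₁, u₂⟩ := hU
  obtain ⟨u₃, u₄⟩ := hU'
  obtain ⟨e₁, e₂, -, -, e₅, -, -⟩ := oU
  obtain ⟨d₁, -, d₃, d₄, -, -, -⟩ := oU'
  rcases int_cases_of_abs_lt (x := U' - U - 2 * P) (by linarith) (by linarith) (by linarith) with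
    rfl | rfl | rfl <;> push_cast at eU <;> subst eT eU <;> simp only [ArcE, ArcW] <;> grind

theorem arcN_shift (hP0 : 0 < P) (hP1 : P < 1) (hT : T ∈ Ioo (-1) 1)
    (hU : U ∈ Ioo (-1) 1) (hU' : U' ∈ Ioo (-1) 1) (eU : U' = U - P + 2 * b) :
    ArcN P T U ↔ ArcS P T U' := by
  obtain ⟨t₁, t₂⟩ := hT
  obtain ⟨u₁, u₂⟩ := hU
  obtain ⟨u₃, u₄⟩ := hU'
  rcases int_cases_of_abs_lt (x := U' - U + P) (by linarith) (by linarith) (by linarith) with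
    rfl | rfl | rfl <;> push_cast at eU <;> subst eU <;> simp only [ArcN, ArcS] <;> grind

end Shift

/-- The translation of the cover by a vector that may depend on `P`. -/
def shift (d : Cover → ℝ × ℝ × ℝ) (z : Cover) : Cover := (z.1, z.2 + d z)

/-- If a point and its image under a continuous map of the cover project to the interiors of two
pieces, then some generic point and its image have representatives in the fundamental domain
lying in these pieces. -/
theorem exists_generic_representatives {φ : Cover → Cover} (hφ : Continuous φ) {z : Cover}
    {t t' : TileType} (h : (Quotient.mk latticeSetoid z) ∈ interior (piece t))
    (h' : (Quotient.mk latticeSetoid (φ z)) ∈ interior (piece t')) :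
    ∃ y w w' : Cover, Generic y ∧ latticeSetoid w y ∧ latticeSetoid w' (φ y) ∧
      w ∈ domainPiece t ∧ w' ∈ domainPiece t' := by
  have hq : Continuous (Quotient.mk latticeSetoid) := continuous_quotient_mk'
  obtain ⟨y, ⟨hy, hy'⟩, hg⟩ := exists_generic
    ((isOpen_interior.preimage hq).inter (isOpen_interior.preimage (hq.comp hφ))) ⟨z, h, h'⟩
  obtain ⟨w, hw, e⟩ := interior_subset hy
  obtain ⟨w', hw', e'⟩ := interior_subset hy'
  exact ⟨y, w, w', hg, Quotient.exact e, Quotient.exact e', hw, hw'⟩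

/-! ### Uniqueness of the tile type -/

theorem eq_of_mem_interior_piece {x : X} {t t' : TileType} (h : x ∈ interior (piece t))
    (h' : x ∈ interior (piece t')) : t = t' := by
  obtain ⟨z, rfl⟩ := Quotient.exists_rep x
  obtain ⟨y, w, w', hg, r, r', hw, hw'⟩ := exists_generic_representatives continuous_id h h'
  have gw := hg.of_rel (latticeSetoid.symm r)
  have gw' := hg.of_rel (latticeSetoid.symm r')
  obtain ⟨⟨bt, bu, bv⟩, hl⟩ := gw.mem_domainPiece hw
  obtain ⟨⟨bt', bu', bv'⟩, hl'⟩ := gw'.mem_domainPiece hw'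
  obtain ⟨eP, a, b, c, e⟩ := latticeSetoid.trans r (latticeSetoid.symm r')
  have key {k : ℤ} {x x' : ℝ} (h : x ∈ Ioo (-1 : ℝ) 1) (h' : x' ∈ Ioo (-1 : ℝ) 1)
      (e : x' = x + 2 * k) : k = 0 := by
    have h₁ : (-1 : ℝ) < k := by linarith [h.1, h.2, h'.1, h'.2]
    have h₂ : (k : ℝ) < 1 := by linarith [h.1, h.2, h'.1, h'.2]
    have h₁ : -1 < k := by exact_mod_cast h₁
    have h₂ : k < 1 := by exact_mod_cast h₂
    omega
  -- The `T₁` exponent must vanish first, since it contributes `aP` to the other two coordinates.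
  obtain rfl : a = 0 := key bt bt' (by rw [e])
  obtain rfl : b = 0 := key bu bu' (by rw [e]; simp)
  obtain rfl : c = 0 := key bv bv' (by rw [e]; simp)
  have : w' = w := Prod.ext eP.symm (by rw [e]; simp)
  subst this
  exact Subtype.ext (Finset.ext fun s => (hl s).trans (hl' s).symm)

/-! ### Matching across shared edges -/

theorem east_mem_iff_west_mem {P : Icc (0 : ℝ) 1} {v : ℝ × ℝ × ℝ} {t t' : TileType}
    (h : (Quotient.mk latticeSetoid (P, v)) ∈ interior (piece t))
    (h' : (Quotient.mk latticeSetoid (P, v + (2 * (P : ℝ), 2 * (P : ℝ), 2 * (P : ℝ)))) ∈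
      interior (piece t')) : Side.E ∈ t.1 ↔ Side.W ∈ t'.1 := by
  -- The translation vector varies with the first coordinate, so it remains the eastward step after
  -- `P` is perturbed.
  obtain ⟨y, w, w', hg, r, r', hw, hw'⟩ := exists_generic_representatives
    (φ := shift fun z => (2 * (z.1 : ℝ), 2 * (z.1 : ℝ), 2 * (z.1 : ℝ)))
    (by unfold shift; fun_prop) h h'
  have gw := hg.of_rel (latticeSetoid.symm r)
  have gw' : Generic w' := by
    refine Generic.of_rel (z := shift (fun z => (2 * (z.1 : ℝ), 2 * (z.1 : ℝ), 2 * (z.1 : ℝ))) y)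
      (hg.translate rfl 0 2 0 2 0 2 ?_ ?_ ?_) (latticeSetoid.symm r') <;> simp [shift]
  obtain ⟨⟨bt, bu, bv⟩, hl⟩ := gw.mem_domainPiece hw
  obtain ⟨⟨bt', bu', bv'⟩, hl'⟩ := gw'.mem_domainPiece hw'
  rw [hl, hl']
  have ou := offWalls_of_ne gw.snd
  have ov := offWalls_of_ne gw.trd
  have ou' := offWalls_of_ne gw'.snd
  have ov' := offWalls_of_ne gw'.trd
  have n₂ := gw'.fst_ne.2.2.1
  have hP0 := gw.pos
  have hP1 := gw.lt_one
  obtain ⟨eP, a, b, c, e⟩ := r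
  obtain ⟨eP', a', b', c', e'⟩ := latticeSetoid.symm r'
  obtain ⟨Q, T, U₁, U₂⟩ := w
  obtain ⟨Q', T', U₁', U₂'⟩ := w'
  obtain ⟨R, y⟩ := y
  simp only [shift] at *
  subst eP eP'
  subst e
  simp only [Prod.mk_add_mk, Prod.mk.injEq] at e'
  obtain ⟨eT, eU, eV⟩ := e'
  -- `2(a + a') = T' - T - 2P` lies in `(-4, 2)`, which leaves two possible exponents of `T₁`.
  have h₁ : (-2 : ℝ) < (a + a' : ℤ) := by
    push_cast; linarith [bt.1, bt.2, bt'.1, bt'.2]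
  have h₂ : ((a + a' : ℤ) : ℝ) < 1 := by
    push_cast; linarith [bt.1, bt.2, bt'.1, bt'.2]
  have h₁ : -2 < a + a' := by exact_mod_cast h₁
  have h₂ : a + a' < 1 := by exact_mod_cast h₂
  obtain ha | ha : a + a' = -1 ∨ a + a' = 0 := by omega
  · have ha : (a : ℝ) = -1 - a' := by exact_mod_cast (by omega : a = -1 - a')
    rw [ha] at eT eU eV
    simp only [colArc, rowArc]
    rw [arcE_shift_of_neg (b := b + b') hP0 hP1 bt bt' bu bu' n₂ (by linarith)
        (by push_cast; linarith),
      arcE_shift_of_neg (b := c + c') hP0 hP1 bt bt' bv bv' n₂ (by linarith)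
        (by push_cast; linarith)]
  · have ha : (a : ℝ) = - a' := by exact_mod_cast (by omega : a = - a')
    rw [ha] at eT eU eV
    simp only [colArc, rowArc]
    rw [arcE_shift_of_zero (b := b + b') hP0 hP1 bt bt' bu bu' n₂ ou ou' (by linarith)
        (by push_cast; linarith),
      arcE_shift_of_zero (b := c + c') hP0 hP1 bt bt' bv bv' n₂ ov ov' (by linarith)
        (by push_cast; linarith), xor_not_not]

theorem north_mem_iff_south_mem {P : Icc (0 : ℝ) 1} {v : ℝ × ℝ × ℝ} {t t' : TileType}
    (h : (Quotient.mk latticeSetoid (P, v)) ∈ interior (piece t))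
    (h' : (Quotient.mk latticeSetoid (P, v + (2, 0, 2 * (P : ℝ)))) ∈
      interior (piece t')) : Side.N ∈ t.1 ↔ Side.S ∈ t'.1 := by
  obtain ⟨y, w, w', hg, r, r', hw, hw'⟩ := exists_generic_representatives
    (φ := shift fun z => (2, 0, 2 * (z.1 : ℝ))) (by unfold shift; fun_prop) h h'
  have gw := hg.of_rel (latticeSetoid.symm r)
  have gw' : Generic w' := by
    refine Generic.of_rel (z := shift (fun z => (2, 0, 2 * (z.1 : ℝ))) y)
      (hg.translate rfl 2 0 0 0 0 2 ?_ ?_ ?_) (latticeSetoid.symm r') <;> simp [shift]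
  obtain ⟨⟨bt, bu, bv⟩, hl⟩ := gw.mem_domainPiece hw
  obtain ⟨⟨bt', bu', bv'⟩, hl'⟩ := gw'.mem_domainPiece hw'
  rw [hl, hl']
  have hP0 := gw.pos
  have hP1 := gw.lt_one
  obtain ⟨eP, a, b, c, e⟩ := r
  obtain ⟨eP', a', b', c', e'⟩ := latticeSetoid.symm r'
  obtain ⟨Q, T, U₁, U₂⟩ := w
  obtain ⟨Q', T', U₁', U₂'⟩ := w'
  obtain ⟨R, y⟩ := y
  simp only [shift] at *
  subst eP eP'
  subst e
  simp only [Prod.mk_add_mk, Prod.mk.injEq] at e'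
  obtain ⟨eT, eU, eV⟩ := e'
  -- Here `2(a + a') = T' - T - 2` lies in `(-4, 0)`, so `T₁⁻¹` is forced; the net move is `(0, -P,
  -- P)` modulo 2 in the last two coordinates.
  have h₁ : (-2 : ℝ) < (a + a' : ℤ) := by
    push_cast; linarith [bt.1, bt.2, bt'.1, bt'.2]
  have h₂ : ((a + a' : ℤ) : ℝ) < 0 := by
    push_cast; linarith [bt.1, bt.2, bt'.1, bt'.2]
  have h₁ : -2 < a + a' := by exact_mod_cast h₁
  have h₂ : a + a' < 0 := by exact_mod_cast h₂
  have ha : (a : ℝ) = -1 - a' := by exact_mod_cast (by omega : a = -1 - a')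
  rw [ha] at eT eU eV
  obtain rfl : T' = T := by linarith
  simp only [colArc, rowArc]
  -- Rows rotate by `+P` and have the `N` and `S` arcs exchanged, so the same lemma applies from the
  -- new point back to the old one.
  rw [arcN_shift (b := b + b') hP0 hP1 bt bu bu' (by push_cast; linarith),
    arcN_shift (b := -(c + c')) hP0 hP1 bt bv' bv (by push_cast; linarith)]

end Plaid

theorem mainTheorem9 (P : Set.Icc (0 : ℝ) 1) (V : ℝ × ℝ × ℝ) (hV : Plaid.GoodOffset P V) :
    ∃ τ : Plaid.Tiling, Plaid.IsTilingOf P V τ ∧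
      (∀ τ' : Plaid.Tiling, Plaid.IsTilingOf P V τ' → τ' = τ) ∧
      Plaid.Coherent τ := by
  choose τ hτ using hV
  refine ⟨τ, hτ, fun τ' h => funext fun s => Plaid.eq_of_mem_interior_piece (h s) (hτ s),
    fun m n => ⟨?_, ?_⟩⟩
  · refine Plaid.east_mem_iff_west_mem (hτ (m, n)) ?_
    convert hτ (m + 1, n) using 1
    simp only [Plaid.Xi, Plaid.center]
    congr 2
    ext <;> simp <;> ring
  · refine Plaid.north_mem_iff_south_mem (hτ (m, n)) ?_
    convert hτ (m, n + 1) using 1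
    simp only [Plaid.Xi, Plaid.center]
    congr 2
    ext <;> simp <;> ring
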